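/- Graphs are finite and undirected, with nonnegative edge weights; self-loops are allowed and every vertex has positive degree. For such a graph $G$ on $n\ge 1$ vertices, with weighted adjacency matrix $\tilde A$ and diagonal degree matrix $D$, the spectral density of $G$ is the uniform distribution on the $n$ eigenvalues (with multiplicity) of $D^{-1/2}\tilde A D^{-1/2}$, and a random walk step from $v$ moves to $u$ with probability $(D^{-1}\tilde A)_{v,u}$. An adaptive random walk algorithm with $s$ steps for graphs on the vertex set $\{1,\dots,n\}$ is a randomized algorithm (with arbitrary internal randomness) whose only access to $G$ is as follows: at each point, depending on its randomness and on everything seen so far, it may receive a uniformly random vertex, or start a random walk of any length $T\ge 0$ of its choice at any vertex of its choice and observe the labels of all visited vertices. In every execution it stops after finitely many such operations, the total length of all its walks is at most $s$, and it outputs a probability distribution $q$ on $\mathbb R$. It succeeds on $G$ with accuracy $\varepsilon$ if the Wasserstein-1 distance between $q$ and the spectral density of $G$ is at most $\varepsilon$. **Theorem.** Let $0<\varepsilon<1/6$. No adaptive random walk algorithm with $s$ steps approximates the spectral density of every given graph $G$ to accuracy $\varepsilon$ in the Wasserstein-1 distance with probability greater than $3/4$, unless $s\ge \frac{1}{36\varepsilon^2}$.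 This holds even for algorithms that are only required to work for graphs on $n$ vertices, for some number $n\ge 1$ that depends only on $\varepsilon$. -/

import Mathlib

open MeasureTheory
open scoped ENNReal

noncomputable section

/-- The Wasserstein-1 distance of two measures on the real line: the infimum, over all couplings,
of the cost of moving the mass of `μ` to `ν`. -/
def wassersteinOne (μ ν : Measure ℝ) : ℝ≥0∞ :=
  ⨅ (γ : Measure (ℝ × ℝ)) (_ : γ.map Prod.fst = μ ∧ γ.map Prod.snd = ν),
    ∫⁻ z, edist z.1 z.2 ∂γ

/-- A finite undirected graph on the labelled vertex set `V` with nonnegative edge weights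
(weight `0` means that there is no edge). Self-loops are allowed. Every vertex has positive degree,
so that the random walk and the normalized adjacency matrix make sense. -/
structure WeightedGraph (V : Type*) [Fintype V] where
  /-- the weighted adjacency matrix -/
  weight : V → V → ℝ
  weight_nonneg : ∀ u v, 0 ≤ weight u v
  weight_symm : ∀ u v, weight u v = weight v u
  degree_pos : ∀ v, 0 < ∑ u, weight v u

namespace WeightedGraph

variable {V : Type*} [Fintype V] (G : WeightedGraph V)

/-- The weighted degree of a vertex. -/
def degree (v : V) : ℝ := ∑ u, G.weight v u

/-- The normalized adjacency matrix `D^{-1/2} Ã D^{-1/2}`. -/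
def normalizedAdjacency : Matrix V V ℝ :=
  Matrix.of fun u v => (√(G.degree u))⁻¹ * G.weight u v * (√(G.degree v))⁻¹

theorem normalizedAdjacency_isHermitian : G.normalizedAdjacency.IsHermitian := by
  ext u v
  simp only [normalizedAdjacency, Matrix.conjTranspose_apply, Matrix.of_apply, star_trivial]
  rw [G.weight_symm v u]
  ring

/-- The spectral density: the uniform distribution on the eigenvalues (with multiplicity) of the
normalized adjacency matrix. -/
def spectralDensity [DecidableEq V] : Measure ℝ :=
  (Fintype.card V : ℝ≥0∞)⁻¹ •
    ∑ i, Measure.dirac (G.normalizedAdjacency_isHermitian.eigenvalues i)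

theorem sum_stepProb (v : V) :
    ∑ u, ENNReal.ofReal (G.weight v u / G.degree v) = 1 := by
  have hd : 0 < G.degree v := G.degree_pos v
  rw [← ENNReal.ofReal_sum_of_nonneg fun u _ => div_nonneg (G.weight_nonneg v u) hd.le,
    ← Finset.sum_div]
  change ENNReal.ofReal (G.degree v / G.degree v) = 1
  rw [div_self hd.ne', ENNReal.ofReal_one]

/-- One step of the random walk from `v`: move to `u` with probability the `(v, u)` entry of
`D^{-1} Ã`. -/
def step (v : V) : PMF V :=
  PMF.ofFintype (fun u => ENNReal.ofReal (G.weight v u / G.degree v)) (G.sum_stepProb v)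

/-- The law of the transcript `v₁, …, v_T` of a random walk of `T` steps started at `v₀ = v`. -/
def walk : (T : ℕ) → V → PMF (Fin T → V)
  | 0, _ => PMF.pure Fin.elim0
  | T + 1, v => (G.step v).bind fun u =>
      (walk T u).map fun t => (Fin.cons u t : Fin (T + 1) → V)

end WeightedGraph

/-- A deterministic adaptive random walk algorithm for graphs on the labelled vertex set `V`, making
at most `s` random walk steps in every execution. Knowing the whole transcript so far, it
* stops and outputs a probability distribution on the real line, or
* receives a uniformly random vertex (free of charge), or
* starts a random walk at a vertex of its choice, of a length `T` of its choice, and sees the labels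
  of all visited vertices; this costs `T` steps.
A walk can be prolonged by starting a new walk at its last vertex. -/
inductive AdaptiveAlgorithm (V : Type*) : ℕ → Type _
  | output {s : ℕ} (q : ProbabilityMeasure ℝ) : AdaptiveAlgorithm V s
  | sample {s : ℕ} (next : V → AdaptiveAlgorithm V s) : AdaptiveAlgorithm V s
  | walk {s : ℕ} (v : V) (T : ℕ) (next : (Fin T → V) → AdaptiveAlgorithm V s) :
      AdaptiveAlgorithm V (s + T)

namespace AdaptiveAlgorithm

variable {V : Type*} [Fintype V] [Nonempty V]

/-- The law of the output of a deterministic algorithm that is run on the graph `G`. -/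
def outputLaw (G : WeightedGraph V) :
    {s : ℕ} → AdaptiveAlgorithm V s → PMF (ProbabilityMeasure ℝ)
  | _, output q => PMF.pure q
  | _, sample next => (PMF.uniformOfFintype V).bind fun v => outputLaw G (next v)
  | _, walk v T next => (G.walk T v).bind fun t => outputLaw G (next t)

/-- The probability that the output of a randomized algorithm, run on `G`, is within Wasserstein-1
distance `ε` of the spectral density of `G`. The internal randomness of the algorithm is a seed
`ω`, of law `μ`, which is drawn in advance: `A ω` is the deterministic algorithm that is run with
the seed `ω`. (The integral is the lower integral where the integrand is not measurable, so no
measurability of `A` is needed: the success probability is never overestimated.) -/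
def successProb [DecidableEq V] {Ω : Type*} [MeasurableSpace Ω] (μ : Measure Ω) {s : ℕ}
    (A : Ω → AdaptiveAlgorithm V s) (G : WeightedGraph V) (ε : ℝ) : ℝ≥0∞ :=
  ∫⁻ ω, (outputLaw G (A ω)).toOuterMeasure
    {q | wassersteinOne (q : Measure ℝ) G.spectralDensity ≤ ENNReal.ofReal ε} ∂μ

end AdaptiveAlgorithm

end

/-! ### Lower bounds on the Wasserstein distance -/

/-! Two graphs on two vertices suffice: the walk stays put with probability `(1 + t) / 2`, where `t
= ±3ε`. The eigenvalues are `1` and `t`, so the mean eigenvalues differ by `3ε > 2ε` and no output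
is `ε`-close to both densities (`trace_le_trace_add`). One step from any vertex has Hellinger
affinity at least `√(1 - 9ε²)`. Affinity lower bounds multiply along an adaptive execution
(`mul_le_affinity_bind`), so `s` steps leave affinity at least `(1 - 9ε²)^(s/2)`. For `s < 1/(36ε²)`
its square exceeds `3/4`, and Le Cam's inequality bounds the sum of the two success probabilities by
`3/2`. -/

/-- The easy half of Kantorovich duality: integrate `h` against an arbitrary coupling. -/
theorem lintegral_le_lintegral_add_wassersteinOne {f : ℝ → ℝ≥0∞} (hf : Measurable f)
    (h : ∀ x y, f x ≤ f y + edist x y) (μ ν : Measure ℝ) :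
    ∫⁻ x, f x ∂μ ≤ ∫⁻ x, f x ∂ν + wassersteinOne μ ν := by
  rw [← tsub_le_iff_left]
  refine le_iInf₂ fun γ hγ => ?_
  rw [tsub_le_iff_left, ← hγ.1, ← hγ.2, lintegral_map hf measurable_fst,
    lintegral_map hf measurable_snd, ← lintegral_add_left (f := fun z : ℝ × ℝ => f z.2) (hf.comp measurable_snd)]
  exact lintegral_mono fun z => h z.1 z.2

theorem wassersteinOne_comm (μ ν : Measure ℝ) : wassersteinOne μ ν = wassersteinOne ν μ := by
  have key : ∀ μ ν : Measure ℝ, wassersteinOne μ ν ≤ wassersteinOne ν μ := by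
    refine fun μ ν => le_iInf₂ fun γ hγ => ?_
    have h1 : (γ.map Prod.swap).map Prod.fst = μ := by
      rw [Measure.map_map measurable_fst measurable_swap]
      exact hγ.2
    have h2 : (γ.map Prod.swap).map Prod.snd = ν := by
      rw [Measure.map_map measurable_snd measurable_swap]
      exact hγ.1
    refine (iInf₂_le (γ.map Prod.swap) ⟨h1, h2⟩).trans_eq ?_
    rw [lintegral_map (by fun_prop) measurable_swap]
    simp only [Prod.fst_swap, Prod.snd_swap, edist_comm]
  exact le_antisymm (key μ ν) (key ν μ)

theorem WeightedGraph.sum_eigenvalues {V : Type*} [Fintype V] [DecidableEq V]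
    (G : WeightedGraph V) :
    ∑ i, G.normalizedAdjacency_isHermitian.eigenvalues i = G.normalizedAdjacency.trace := by
  simpa using G.normalizedAdjacency_isHermitian.trace_eq_sum_eigenvalues.symm

/-- The distances of a measure from two spectral densities add up to at least the difference of the
mean eigenvalues. -/
theorem WeightedGraph.trace_le_trace_add {V : Type*} [Fintype V] [DecidableEq V] [Nonempty V]
    (G H : WeightedGraph V) (q : Measure ℝ) {ε : ℝ} (hε : 0 ≤ ε)
    (hG : wassersteinOne q G.spectralDensity ≤ ENNReal.ofReal ε)
    (hH : wassersteinOne q H.spectralDensity ≤ ENNReal.ofReal ε) :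
    G.normalizedAdjacency.trace ≤
      H.normalizedAdjacency.trace + Fintype.card V * (2 * ε) := by
  set a := G.normalizedAdjacency_isHermitian.eigenvalues with ha
  set b := H.normalizedAdjacency_isHermitian.eigenvalues with hb
  -- The shift `K` keeps `ENNReal.ofReal` from truncating at the eigenvalues of `H`. At those of `G`
  -- truncation may occur, but subadditivity of `ENNReal.ofReal` gives the direction needed.
  set K := ∑ i, |b i|
  have hK : ∀ i, 0 ≤ b i + K := fun i => by
    have h1 : |b i| ≤ K :=
      Finset.single_le_sum (f := fun i => |b i|) (fun j _ => abs_nonneg _) (Finset.mem_univ i)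
    linarith [neg_abs_le (b i)]
  set f : ℝ → ℝ≥0∞ := fun x => ENNReal.ofReal (x + K)
  have hf : Measurable f := by fun_prop
  have hL : ∀ x y, f x ≤ f y + edist x y := fun x y => by
    rw [edist_dist, Real.dist_eq]
    refine (ENNReal.ofReal_le_ofReal ?_).trans ENNReal.ofReal_add_le
    linarith [le_abs_self (x - y)]
  have h1 := lintegral_le_lintegral_add_wassersteinOne hf hL G.spectralDensity q
  have h2 := lintegral_le_lintegral_add_wassersteinOne hf hL q H.spectralDensity
  rw [wassersteinOne_comm] at h1
  have h3 : ∫⁻ x, f x ∂G.spectralDensity ≤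
      ∫⁻ x, f x ∂H.spectralDensity + ENNReal.ofReal (2 * ε) := by
    rw [two_mul, ENNReal.ofReal_add hε hε, ← add_assoc]
    exact h1.trans (add_le_add (h2.trans (add_le_add le_rfl hH)) hG)
  have hn : (Fintype.card V : ℝ≥0∞) ≠ 0 := by simp
  have hn' : (Fintype.card V : ℝ≥0∞) ≠ ∞ := ENNReal.natCast_ne_top _
  simp only [WeightedGraph.spectralDensity, lintegral_smul_measure, lintegral_finsetSum_measure,
    lintegral_dirac, smul_eq_mul] at h3
  have h4 := mul_le_mul_right h3 (Fintype.card V : ℝ≥0∞)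
  rw [mul_add, ← mul_assoc, ← mul_assoc, ENNReal.mul_inv_cancel hn hn', one_mul, one_mul] at h4
  have h5 : ENNReal.ofReal (∑ i, (a i + K)) ≤
      ENNReal.ofReal (∑ i, (b i + K) + Fintype.card V * (2 * ε)) := by
    refine (Finset.le_sum_of_subadditive _ ENNReal.ofReal_zero.le
      (fun _ _ => ENNReal.ofReal_add_le) _ _).trans (h4.trans_eq ?_)
    rw [ENNReal.ofReal_add (Finset.sum_nonneg fun i _ => hK i) (by positivity),
      ENNReal.ofReal_sum_of_nonneg fun i _ => hK i, ENNReal.ofReal_mul (Nat.cast_nonneg _),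
      ENNReal.ofReal_natCast]
  rw [ENNReal.ofReal_le_ofReal_iff (add_nonneg (Finset.sum_nonneg fun i _ => hK i)
    (by positivity)), Finset.sum_add_distrib, Finset.sum_add_distrib, ha, hb,
    WeightedGraph.sum_eigenvalues, WeightedGraph.sum_eigenvalues] at h5
  linarith

/-! ### The Hellinger affinity of two probability mass functions -/

theorem ENNReal.tsum_mul_le_sqrt_mul_sqrt {α : Type*} (f g : α → ℝ≥0∞) :
    ∑' x, f x ^ (1 / 2 : ℝ) * g x ^ (1 / 2 : ℝ) ≤
      (∑' x, f x) ^ (1 / 2 : ℝ) * (∑' x, g x) ^ (1 / 2 : ℝ) := by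
  let _ : MeasurableSpace α := ⊤
  have h := ENNReal.lintegral_mul_le_Lp_mul_Lq (Measure.count : Measure α)
    (p := 2) (q := 2) (by constructor <;> norm_num)
    (f := fun x => f x ^ (1 / 2 : ℝ)) (g := fun x => g x ^ (1 / 2 : ℝ))
    (measurable_from_top.aemeasurable) (measurable_from_top.aemeasurable)
  simpa only [lintegral_count, ← ENNReal.rpow_mul, Pi.mul_apply, one_div,
    inv_mul_cancel₀ (two_ne_zero' ℝ), ENNReal.rpow_one] using h

namespace PMF

variable {α β : Type*}

/-- The Hellinger affinity (Bhattacharyya coefficient). -/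
noncomputable def affinity (P Q : PMF α) : ℝ≥0∞ := ∑' x, P x ^ (1 / 2 : ℝ) * Q x ^ (1 / 2 : ℝ)

theorem affinity_self (P : PMF α) : P.affinity P = 1 := by
  simp only [affinity, ← ENNReal.rpow_add_of_nonneg _ _ (by norm_num : (0 : ℝ) ≤ 1 / 2)
    (by norm_num : (0 : ℝ) ≤ 1 / 2)]
  norm_num [P.tsum_coe]

/-- The affinity of the joint laws of `(x, y)` is at least `b * c`; forgetting `x` does not lower
it, by Cauchy–Schwarz. Since `c` is uniform in `x`, the continuation may depend on `x`, which is how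
adaptivity is handled. -/
theorem mul_le_affinity_bind {P Q : PMF α} {f g : α → PMF β} {b c : ℝ≥0∞}
    (hPQ : b ≤ P.affinity Q) (hfg : ∀ x, c ≤ (f x).affinity (g x)) :
    b * c ≤ (P.bind f).affinity (Q.bind g) := by
  have hh : (0 : ℝ) ≤ 1 / 2 := by norm_num
  calc b * c ≤ P.affinity Q * c := mul_le_mul_left hPQ c
    _ = ∑' x, P x ^ (1 / 2 : ℝ) * Q x ^ (1 / 2 : ℝ) * c := by
      rw [affinity, ENNReal.tsum_mul_right]
    _ ≤ ∑' x, P x ^ (1 / 2 : ℝ) * Q x ^ (1 / 2 : ℝ) * (f x).affinity (g x) :=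
      ENNReal.tsum_le_tsum fun x => mul_le_mul_right (hfg x) _
    _ = ∑' y, ∑' x, (P x * f x y) ^ (1 / 2 : ℝ) * (Q x * g x y) ^ (1 / 2 : ℝ) := by
      rw [ENNReal.tsum_comm]
      refine tsum_congr fun x => ?_
      rw [affinity, ← ENNReal.tsum_mul_left]
      refine tsum_congr fun y => ?_
      rw [ENNReal.mul_rpow_of_nonneg _ _ hh, ENNReal.mul_rpow_of_nonneg _ _ hh]
      ring
    _ ≤ (P.bind f).affinity (Q.bind g) :=
      ENNReal.tsum_le_tsum fun y => by
        rw [bind_apply, bind_apply]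
        exact ENNReal.tsum_mul_le_sqrt_mul_sqrt _ _

theorem le_affinity_map {P Q : PMF α} (f : α → β) {b : ℝ≥0∞} (hPQ : b ≤ P.affinity Q) :
    b ≤ (P.map f).affinity (Q.map f) := by
  have h := mul_le_affinity_bind (f := pure ∘ f) (g := pure ∘ f) (c := 1) hPQ
    fun x => (affinity_self _).ge
  rwa [mul_one] at h

theorem toOuterMeasure_add_compl (P : PMF α) (S : Set α) :
    P.toOuterMeasure S + P.toOuterMeasure Sᶜ = 1 := by
  rw [toOuterMeasure_apply, toOuterMeasure_apply, ← ENNReal.tsum_add, ← P.tsum_coe]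
  exact tsum_congr fun x => Set.indicator_self_add_compl_apply S P x

/-- Cauchy–Schwarz on `S` and on `Sᶜ` separately reduces to two-point distributions. -/
theorem affinity_le_of_set (P Q : PMF α) (S : Set α) :
    P.affinity Q ≤ P.toOuterMeasure S ^ (1 / 2 : ℝ) * Q.toOuterMeasure S ^ (1 / 2 : ℝ) +
      P.toOuterMeasure Sᶜ ^ (1 / 2 : ℝ) * Q.toOuterMeasure Sᶜ ^ (1 / 2 : ℝ) := by
  simp only [toOuterMeasure_apply]
  refine le_trans (le_of_eq ?_) (add_le_add (ENNReal.tsum_mul_le_sqrt_mul_sqrt _ _)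
    (ENNReal.tsum_mul_le_sqrt_mul_sqrt _ _))
  rw [← ENNReal.tsum_add]
  refine tsum_congr fun x => ?_
  by_cases hx : x ∈ S <;> simp [hx]

/-- Le Cam's inequality. -/
theorem sq_add_sq_toOuterMeasure_sub_le (P Q : PMF α) (S : Set α) {b : ℝ} (hb : 0 ≤ b)
    (hPQ : ENNReal.ofReal b ≤ P.affinity Q) :
    b ^ 2 + ((P.toOuterMeasure S).toReal - (Q.toOuterMeasure S).toReal) ^ 2 ≤ 1 := by
  have key : ∀ P : PMF α, ∃ x : ℝ, 0 ≤ x ∧ x ≤ 1 ∧ P.toOuterMeasure S = ENNReal.ofReal x ∧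
      P.toOuterMeasure Sᶜ = ENNReal.ofReal (1 - x) := fun P => by
    have h := P.toOuterMeasure_add_compl S
    have h1 : P.toOuterMeasure S ≤ 1 := h ▸ le_self_add
    have hne : P.toOuterMeasure S ≠ ∞ := ne_top_of_le_ne_top ENNReal.one_ne_top h1
    refine ⟨(P.toOuterMeasure S).toReal, ENNReal.toReal_nonneg,
      ENNReal.toReal_le_of_le_ofReal zero_le_one (by simpa using h1),
      (ENNReal.ofReal_toReal hne).symm, ?_⟩
    rw [ENNReal.ofReal_sub _ ENNReal.toReal_nonneg, ENNReal.ofReal_toReal hne, ENNReal.ofReal_one,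
      ← h, ENNReal.add_sub_cancel_left hne]
  obtain ⟨x, hx0, hx1, hx, hx'⟩ := key P
  obtain ⟨y, hy0, hy1, hy, hy'⟩ := key Q
  have h := hPQ.trans (affinity_le_of_set P Q S)
  have hx2 := sub_nonneg.2 hx1
  have hy2 := sub_nonneg.2 hy1
  have hh : (0 : ℝ) ≤ 1 / 2 := by norm_num
  rw [hx, hx', hy, hy', ENNReal.ofReal_rpow_of_nonneg hx0 hh, ENNReal.ofReal_rpow_of_nonneg hy0 hh,
    ENNReal.ofReal_rpow_of_nonneg hx2 hh, ENNReal.ofReal_rpow_of_nonneg hy2 hh,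
    ← ENNReal.ofReal_mul (by positivity), ← ENNReal.ofReal_mul (by positivity),
    ← ENNReal.ofReal_add (by positivity) (by positivity),
    ENNReal.ofReal_le_ofReal_iff (by positivity), ← Real.sqrt_eq_rpow, ← Real.sqrt_eq_rpow,
    ← Real.sqrt_eq_rpow, ← Real.sqrt_eq_rpow] at h
  rw [hx, hy, ENNReal.toReal_ofReal hx0, ENNReal.toReal_ofReal hy0]
  have e1 := Real.sq_sqrt hx0
  have e2 := Real.sq_sqrt hy0
  have e3 := Real.sq_sqrt hx2
  have e4 := Real.sq_sqrt hy2
  have h' : b ^ 2 ≤ (√x * √y + √(1 - x) * √(1 - y)) ^ 2 := pow_le_pow_left₀ hb h 2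
  generalize √x = p at *
  generalize √y = r at *
  generalize √(1 - x) = u at *
  generalize √(1 - y) = v at *
  have hv : v ^ 2 = 1 - r ^ 2 := by linarith
  have hu : u ^ 2 = 1 - p ^ 2 := by linarith
  -- With `p, u = cos α, sin α` and `r, v = cos β, sin β`, this splits `sin² (α - β)` by the factors
  -- `sin² (α + β)` and `cos² (α + β)`.
  have h3 : (p * r + u * v) ^ 2 = 1 - (p ^ 2 - r ^ 2) ^ 2 - (p * u - r * v) ^ 2 := by
    linear_combination (v ^ 2 + p ^ 2) * hu + (1 - p ^ 2 + r ^ 2) * hv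
  rw [← e1, ← e2]
  nlinarith [sq_nonneg (p * u - r * v)]

end PMF

/-! ### Two graphs on which the algorithm sees similar transcripts -/

theorem WeightedGraph.pow_le_affinity_walk {V : Type*} [Fintype V] {G H : WeightedGraph V}
    {c : ℝ≥0∞} (hc : ∀ v, c ≤ (G.step v).affinity (H.step v)) (T : ℕ) (v : V) :
    c ^ T ≤ (G.walk T v).affinity (H.walk T v) := by
  induction T generalizing v with
  | zero => simp [WeightedGraph.walk, PMF.affinity_self]
  | succ T ih =>
    rw [pow_succ']
    exact PMF.mul_le_affinity_bind (hc v) fun u => PMF.le_affinity_map _ (ih u)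

theorem AdaptiveAlgorithm.pow_le_affinity_outputLaw {V : Type*} [Fintype V] [Nonempty V]
    {G H : WeightedGraph V} {c : ℝ≥0∞} (hc1 : c ≤ 1)
    (hc : ∀ v, c ≤ (G.step v).affinity (H.step v)) {s : ℕ} (A : AdaptiveAlgorithm V s) :
    c ^ s ≤ (A.outputLaw G).affinity (A.outputLaw H) := by
  induction A with
  -- Stopping may leave budget unused; `c ≤ 1` absorbs it.
  | output q => simpa [AdaptiveAlgorithm.outputLaw, PMF.affinity_self] using pow_le_one' hc1 _
  | sample next ih =>
    simpa [AdaptiveAlgorithm.outputLaw] using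
      PMF.mul_le_affinity_bind (PMF.affinity_self (PMF.uniformOfFintype V)).ge ih
  | walk v T next ih =>
    rw [pow_add, mul_comm]
    exact PMF.mul_le_affinity_bind (WeightedGraph.pow_le_affinity_walk hc T v) ih

/-- The graph on two vertices whose random walk stays with probability `(1 + t) / 2`. -/
noncomputable def lazyEdge (t : ℝ) (h0 : -1 ≤ t) (h1 : t ≤ 1) : WeightedGraph (Fin 2) where
  weight u v := if u = v then (1 + t) / 2 else (1 - t) / 2
  weight_nonneg u v := by split_ifs <;> linarith
  weight_symm u v := by simp only [eq_comm]
  degree_pos v := by fin_cases v <;> simp [← add_div]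

theorem lazyEdge_degree {t : ℝ} (h0 : -1 ≤ t) (h1 : t ≤ 1) (v : Fin 2) :
    (lazyEdge t h0 h1).degree v = 1 := by
  fin_cases v <;> simp [WeightedGraph.degree, lazyEdge] <;> ring

theorem lazyEdge_trace {t : ℝ} (h0 : -1 ≤ t) (h1 : t ≤ 1) :
    (lazyEdge t h0 h1).normalizedAdjacency.trace = 1 + t := by
  simp [Matrix.trace, WeightedGraph.normalizedAdjacency, lazyEdge_degree]
  simp [lazyEdge]

/-- Negating `t` swaps the probabilities of staying and moving, so both targets contribute the same
product. -/
theorem lazyEdge_step_affinity {t : ℝ} (h0 : -1 ≤ t) (h1 : t ≤ 1) (v : Fin 2) :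
    ENNReal.ofReal √(1 - t ^ 2) ≤ ((lazyEdge t h0 h1).step v).affinity
      ((lazyEdge (-t) (neg_le_neg h1) (by linarith)).step v) := by
  have hh : (0 : ℝ) ≤ 1 / 2 := by norm_num
  have hp : 0 ≤ (1 + t) / 2 := by linarith
  have hq : 0 ≤ (1 - t) / 2 := by linarith
  have hs : √((1 + t) / 2) * √((1 - t) / 2) = √(1 - t ^ 2) / 2 := by
    rw [← Real.sqrt_mul hp, show (1 + t) / 2 * ((1 - t) / 2) = (1 - t ^ 2) / 2 ^ 2 by ring,
      Real.sqrt_div' _ (by norm_num), Real.sqrt_sq (by norm_num)]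
  have key : ∀ u, ((lazyEdge t h0 h1).step v u) ^ (1 / 2 : ℝ) *
      ((lazyEdge (-t) (neg_le_neg h1) (by linarith)).step v u) ^ (1 / 2 : ℝ) =
      ENNReal.ofReal (√(1 - t ^ 2) / 2) := fun u => by
    simp only [WeightedGraph.step, PMF.ofFintype_apply, lazyEdge_degree, div_one]
    rw [← hs]
    by_cases huv : v = u
    · simp only [lazyEdge, huv, if_true, ← sub_eq_add_neg]
      rw [ENNReal.ofReal_rpow_of_nonneg hp hh, ENNReal.ofReal_rpow_of_nonneg hq hh,
        ← ENNReal.ofReal_mul (by positivity), Real.sqrt_eq_rpow, Real.sqrt_eq_rpow]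
    · simp only [lazyEdge, huv, if_false, sub_neg_eq_add]
      rw [ENNReal.ofReal_rpow_of_nonneg hp hh, ENNReal.ofReal_rpow_of_nonneg hq hh,
        ← ENNReal.ofReal_mul (by positivity), Real.sqrt_eq_rpow, Real.sqrt_eq_rpow, mul_comm]
  rw [PMF.affinity, tsum_congr key, tsum_fintype, Fin.sum_univ_two,
    ← ENNReal.ofReal_add (by positivity) (by positivity), add_halves]

theorem mainTheorem3 (ε : ℝ) (hε0 : 0 < ε) (hε : ε < 1 / 6) :
    ∃ (n : ℕ) (_ : NeZero n), ∀ (s : ℕ) (Ω : Type*) [MeasurableSpace Ω] (μ : Measure Ω)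
      [IsProbabilityMeasure μ] (A : Ω → AdaptiveAlgorithm (Fin n) s),
      (∀ G : WeightedGraph (Fin n), 3 / 4 < AdaptiveAlgorithm.successProb μ A G ε) →
        1 / (36 * ε ^ 2) ≤ (s : ℝ) := by
  refine ⟨2, inferInstance, fun s Ω _ μ _ A hA => ?_⟩
  by_contra! hs
  rw [lt_div_iff₀ (by positivity)] at hs
  have h0 : -1 ≤ 3 * ε := by linarith
  have h1 : 3 * ε ≤ 1 := by linarith
  set G := lazyEdge (3 * ε) h0 h1
  set H := lazyEdge (-(3 * ε)) (neg_le_neg h1) (by linarith)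
  set S := {q : ProbabilityMeasure ℝ |
    wassersteinOne (q : Measure ℝ) G.spectralDensity ≤ ENNReal.ofReal ε}
  set S' := {q : ProbabilityMeasure ℝ |
    wassersteinOne (q : Measure ℝ) H.spectralDensity ≤ ENNReal.ofReal ε}
  -- The traces differ by `6ε`, while a common approximation would allow at most `2 * (2ε) = 4ε`.
  have hdisj : S' ⊆ Sᶜ := fun q hq' hq => by
    have h := WeightedGraph.trace_le_trace_add G H q hε0.le hq hq'
    rw [lazyEdge_trace, lazyEdge_trace, Fintype.card_fin] at h
    push_cast at h
    linarith
  have hle : ∀ ω, ((A ω).outputLaw G).toOuterMeasure S + ((A ω).outputLaw H).toOuterMeasure S' ≤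
      ENNReal.ofReal (3 / 2) := fun ω => by
    set P := (A ω).outputLaw G
    set Q := (A ω).outputLaw H
    set r := √(1 - (3 * ε) ^ 2)
    have hr : r ^ 2 = 1 - (3 * ε) ^ 2 := Real.sq_sqrt (by nlinarith)
    have hr1 : ENNReal.ofReal r ≤ 1 :=
      ENNReal.ofReal_le_one.2 (Real.sqrt_le_one.2 (by nlinarith))
    have haff : ENNReal.ofReal r ^ s ≤ P.affinity Q :=
      (A ω).pow_le_affinity_outputLaw hr1 (lazyEdge_step_affinity h0 h1)
    rw [← ENNReal.ofReal_pow (Real.sqrt_nonneg _)] at haff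
    have h := P.sq_add_sq_toOuterMeasure_sub_le Q S (by positivity) haff
    -- Bernoulli's inequality: the squared affinity bound `(r ^ 2) ^ s` is at least `1 - 9ε²s`,
    -- which exceeds `3/4` by `hs`.
    have hB := one_add_mul_le_pow (a := -(3 * ε) ^ 2) (by nlinarith) s
    rw [← sub_eq_add_neg, ← hr] at hB
    rw [← pow_mul, mul_comm s 2, pow_mul] at h
    have hQ := Q.toOuterMeasure_add_compl S
    have hP := P.toOuterMeasure_add_compl S
    have hPt : P.toOuterMeasure S ≠ ∞ :=
      ne_top_of_le_ne_top ENNReal.one_ne_top (hP ▸ le_self_add)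
    have hQt : Q.toOuterMeasure S ≠ ∞ :=
      ne_top_of_le_ne_top ENNReal.one_ne_top (hQ ▸ le_self_add)
    have hQt' : Q.toOuterMeasure Sᶜ ≠ ∞ :=
      ne_top_of_le_ne_top ENNReal.one_ne_top (hQ ▸ le_add_self)
    have hQ' := congrArg ENNReal.toReal hQ
    rw [ENNReal.toReal_add hQt hQt', ENNReal.toReal_one] at hQ'
    have hmono : Q.toOuterMeasure S' ≤ Q.toOuterMeasure Sᶜ := Q.toOuterMeasure.mono hdisj
    refine (add_le_add_right hmono _).trans ?_
    rw [← ENNReal.ofReal_toReal hPt, ← ENNReal.ofReal_toReal hQt',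
      ← ENNReal.ofReal_add ENNReal.toReal_nonneg ENNReal.toReal_nonneg]
    refine ENNReal.ofReal_le_ofReal ?_
    -- The sum is `1 + P(S) - Q(S)`, and by `h` the square of the difference is below `1/4`.
    nlinarith
  have hsum : AdaptiveAlgorithm.successProb μ A G ε + AdaptiveAlgorithm.successProb μ A H ε ≤
      ENNReal.ofReal (3 / 2) :=
    -- Superadditivity of the lower integral holds without measurability in the seed.
    (le_lintegral_add _ _).trans ((lintegral_mono hle).trans_eq (by simp))
  refine (ENNReal.add_lt_add (hA G) (hA H)).not_ge (hsum.trans_eq ?_)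
  rw [show (3 / 2 : ℝ) = 3 / 4 + 3 / 4 by norm_num, ENNReal.ofReal_add (by norm_num) (by norm_num),
    ENNReal.ofReal_div_of_pos (by norm_num)]
  simp
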